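/- Let $M$ be a compact surface, possibly with boundary, with a triangular decomposition $\mathfrak T$: a finite set $F$ of triangles from which $M$ is obtained by gluing certain pairs of distinct sides; sides that are not glued form the boundary. (Sides of the same triangle may be glued to each other. In particular, cell decompositions that lift to a triangulation of the universal cover are of this kind.) Let $V$ and $E$ be the sets of vertices and edges of $\mathfrak T$, with boundary vertices $\partial V$ and boundary edges $\partial E$. A vector $x\in\mathbb R^{3F}$ assigns a real number to each of the $3|F|$ corners of the triangles. An *angle system* is an $x\in\mathbb R^{3F}$ such that the coordinates of $x$ at the corners sitting at a vertex $v$ sum to $2\pi$ if $v\in V\setminus\partial V$ and to $\pi$ if $v\in\partial V$, every coordinate lies in $(0,\pi)$, and the three coordinates in each triangle have sum less than $\pi$. An angle system $u$ is *uniform* if the triangles $t\in F$, realized as hyperbolic triangles with the angles prescribed by $u$, fit together, i.e. any two sides that are glued have the same hyperbolic length (the realizations then glue to a hyperbolic structure with geodesic boundary on $M$). For a side $e$ of a triangle $t$ let $\psi^e_t(x)=\tfrac12(B+C-A)$, where $A$ is the coordinate of $x$ at the corner of $t$ opposite to $e$, and $B,C$ are the coordinates at the other two corners of $t$. For $e\in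 E$ let $\psi^e(x)$ be the sum of these numbers over the sides forming $e$ (two sides if $e\notin\partial E$, one if $e\in\partial E$), and let $\Psi:\mathbb R^{3F}\to\mathbb R^E$ be the linear map $\Psi(x)=(\psi^e(x))_{e\in E}$. For an interior edge $e\in E\setminus\partial E$ formed by two sides, let $w_e\in\mathbb R^{3F}$ be the difference $m-m'$, where $m$ (respectively $m'$) has coefficient $1$ at the two corners adjacent to the first (respectively second) side in its triangle and $0$ elsewhere; $w_e$ is defined up to sign. Let $C=\operatorname{span}\{w_e : e\in E\setminus\partial E\}$ be the space of conformal deformations. Then $\ker\Psi=C$, and for every $p\in\mathbb R^E$ there is at most one uniform angle system $u$ with $\Psi(u)=p$. -/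

import Mathlib

open scoped UpperHalfPlane

noncomputable section

/-- A compact surface (possibly with boundary, orientable or not), decomposed into finitely many
triangles: the surface is obtained from the triangles `t : F` by gluing some of their sides in
pairs.

Each triangle `t` has corners `(t, 0)`, `(t, 1)`, `(t, 2)`, and the side of `t` opposite to the
corner `(t, i)` is also called `(t, i)`.  The side `s` is glued to the side `adj s`; it is a boundary
side if `adj s = s`.  The permutation `glue s` says how: it sends the corner `s.2` opposite to `s`
to the corner opposite to `adj s`, and the end point `(s.1, j)` of `s` (`j ≠ s.2`) is glued to the
end point `((adj s).1, glue s j)` of `adj s`.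

The decomposition need not be a simplicial complex: two sides of one triangle may be glued, and
several corners of a triangle may be the same vertex.  Every cell decomposition of a compact surface
that lifts to a triangulation of the universal cover is of this form. -/
structure TriangulatedSurface (F : Type*) where
  adj : F × Fin 3 → F × Fin 3
  glue : F × Fin 3 → Equiv.Perm (Fin 3)
  adj_adj : ∀ s, adj (adj s) = s
  glue_opposite : ∀ s, glue s s.2 = (adj s).2
  glue_adj : ∀ s, glue (adj s) = (glue s)⁻¹
  glue_boundary : ∀ s, adj s = s → glue s = 1

/-- The point of the unit disc that corresponds to `w` under the conformal isometry (Cayley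
transform) from the upper half-plane to the Poincaré disc that sends `z` to the centre. -/
def toDisc (z w : ℍ) : ℂ :=
  ((w : ℂ) - (z : ℂ)) / ((w : ℂ) - (starRingEnd ℂ) (z : ℂ))

/-- The hyperbolic angle at `z` between the geodesic segments from `z` to `w₁` and from `z` to `w₂`
(for `w₁, w₂ ≠ z`).  After moving `z` to the centre of the Poincaré disc by a conformal isometry
these segments are Euclidean segments from the centre, so it is the Euclidean angle there. -/
def hypAngle (z w₁ w₂ : ℍ) : ℝ :=
  InnerProductGeometry.angle (toDisc z w₁) (toDisc z w₂)

namespace TriangulatedSurface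

variable {F : Type*} (T : TriangulatedSurface F)

/-- Boundary sides: sides that are not glued to another side. -/
def IsBoundarySide (s : F × Fin 3) : Prop := T.adj s = s

/-- Two sides are the same edge if they are equal or glued. -/
def edgeSetoid : Setoid (F × Fin 3) where
  r s s' := s' = s ∨ s' = T.adj s
  iseqv :=
    { refl := fun _ => Or.inl rfl
      symm := by
        rintro s s' (h | h)
        · exact Or.inl h.symm
        · exact Or.inr (by rw [h, T.adj_adj])
      trans := by
        rintro a b c (rfl | rfl) (rfl | rfl)
        · exact Or.inl rfl
        · exact Or.inr rfl
        · exact Or.inr rfl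
        · exact Or.inl (T.adj_adj a) }

/-- The set `E` of edges of the decomposition. -/
def Edge : Type _ := Quotient T.edgeSetoid

/-- The edge that a side of a triangle becomes in the surface. -/
def edge (s : F × Fin 3) : T.Edge := Quotient.mk T.edgeSetoid s

/-- Two corners are directly identified if they are end points of sides `s` and `adj s` that
correspond to each other under the gluing. -/
def CornerGlued (c c' : F × Fin 3) : Prop :=
  ∃ s : F × Fin 3, c.1 = s.1 ∧ c.2 ≠ s.2 ∧ c' = ((T.adj s).1, T.glue s c.2)

/-- The set `V` of vertices: corners modulo the equivalence relation generated by the gluing. -/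
def Vertex : Type _ := Quot T.CornerGlued

/-- The vertex at which a corner of a triangle sits. -/
def vertex (c : F × Fin 3) : T.Vertex := Quot.mk T.CornerGlued c

/-- Boundary vertices: the end points of boundary sides. -/
def IsBoundaryVertex (v : T.Vertex) : Prop :=
  ∃ s : F × Fin 3, T.IsBoundarySide s ∧ ∃ j : Fin 3, j ≠ s.2 ∧ T.vertex (s.1, j) = v

open Classical in
/-- `p^v`: the sum of all the angles at the vertex `v`. -/
def vertexSum [Fintype F] (v : T.Vertex) (x : F × Fin 3 → ℝ) : ℝ :=
  ∑ c : F × Fin 3 with T.vertex c = v, x c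

/-- The curvature `k^t` of a triangle: the sum of its angles minus `π`. -/
def curvature (t : F) (x : F × Fin 3 → ℝ) : ℝ := (∑ i : Fin 3, x (t, i)) - Real.pi

/-- The angle systems: the angles at an interior vertex sum to `2π`, those at a boundary vertex
sum to `π`, all triangles have negative curvature and all angles are in `(0, π)`. -/
def angleSystems [Fintype F] : Set (F × Fin 3 → ℝ) :=
  {x | (∀ v, ¬ T.IsBoundaryVertex v → T.vertexSum v x = 2 * Real.pi) ∧
    (∀ v, T.IsBoundaryVertex v → T.vertexSum v x = Real.pi) ∧
    (∀ t, curvature t x < 0) ∧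
    ∀ c, x c ∈ Set.Ioo 0 Real.pi}

/-- `P` realizes the triangles with angle data `x` in the hyperbolic plane: the points `P t 0`,
`P t 1`, `P t 2` are distinct and the triangle they span has angle `x (t, i)` at `P t i`. -/
def IsRealization (x : F × Fin 3 → ℝ) (P : F → Fin 3 → ℍ) : Prop :=
  ∀ t, Function.Injective (P t) ∧
    ∀ i, hypAngle (P t i) (P t (i + 1)) (P t (i + 2)) = x (t, i)

/-- The hyperbolic length of the side `s` in the realization `P`. -/
def sideLength (P : F → Fin 3 → ℍ) (s : F × Fin 3) : ℝ :=
  dist (P s.1 (s.2 + 1)) (P s.1 (s.2 + 2))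

/-- An angle system is uniform if its triangles, realized in the hyperbolic plane, fit together:
sides that are glued have equal hyperbolic length.  (Realizations are unique up to isometry. Since
the angles of an angle system add up to `2π` at interior and to `π` at boundary vertices, gluing the
realizations isometrically then makes the surface a hyperbolic surface with geodesic boundary.) -/
def IsUniform [Fintype F] (u : F × Fin 3 → ℝ) : Prop :=
  u ∈ T.angleSystems ∧
    ∃ P : F → Fin 3 → ℍ, IsRealization u P ∧ ∀ s, sideLength P s = sideLength P (T.adj s)

/-- The covector `ψ^e_t` for the side `s = e` of `t`: if `A` is the angle opposite to the side and
`B`, `C` are the other two angles of the triangle, its value is `(B + C - A) / 2`. -/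
def psiSide (s : F × Fin 3) : (F × Fin 3 → ℝ) →ₗ[ℝ] ℝ :=
  (1 / 2 : ℝ) • ((LinearMap.proj (s.1, s.2 + 1) : (F × Fin 3 → ℝ) →ₗ[ℝ] ℝ)
    + LinearMap.proj (s.1, s.2 + 2) - LinearMap.proj s)

open Classical in
/-- The covector `ψ^e`, the formal angle complement at the edge `e`: the sum of the `psiSide s` over
the sides `s` (two if `e` is an interior edge, one if `e` is a boundary edge) that form `e`. -/
def psiEdge [Fintype F] (e : T.Edge) : (F × Fin 3 → ℝ) →ₗ[ℝ] ℝ :=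
  ∑ s : F × Fin 3 with T.edge s = e, psiSide s

/-- The linear map `Ψ : ℝ^{3F} → ℝ^E` with coordinates `ψ^e`. -/
def Psi [Fintype F] : (F × Fin 3 → ℝ) →ₗ[ℝ] (T.Edge → ℝ) :=
  LinearMap.pi T.psiEdge

open Classical in
/-- The vector with coefficient `1` at the two angles adjacent to the side `s` in its triangle, and
`0` at all the other angles. -/
def sideVector (s : F × Fin 3) : F × Fin 3 → ℝ :=
  Pi.single (s.1, s.2 + 1) 1 + Pi.single (s.1, s.2 + 2) 1

/-- The vector `w_e` of the interior edge `e` formed by `s` and `adj s`: coefficient `1` at the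
angles adjacent to `e` on one side and `-1` at those adjacent to `e` on the other side.  (Choosing
the other side `adj s` of `e` changes the sign.) -/
def conformalVector (s : F × Fin 3) : F × Fin 3 → ℝ :=
  sideVector s - sideVector (T.adj s)

/-- The space `C` of conformal deformations, spanned by the `w_e` of the interior edges. -/
def conformalDeformations : Submodule ℝ (F × Fin 3 → ℝ) :=
  Submodule.span ℝ {w | ∃ s, ¬ T.IsBoundarySide s ∧ w = T.conformalVector s}

end TriangulatedSurface

end

/-! The vectors `sideVector s` form the basis dual to the covectors `psiSide s`. In these
coordinates `ker Ψ` consists of the vectors that are odd under `T.adj`, and these are spanned by the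
`w_e`.

Uniqueness is a concavity argument. In a triangle, `log (cosh ℓ - 1)` of a side is, up to a
constant, a function `logSide` of the angles, and the sum of these functions times the covectors
`psiSide` is the gradient of a strictly concave function, a combination of volumes of ideal
tetrahedra. For uniform `u`, `v` with `Ψ u = Ψ v`, pair `v - u` with the difference of the
gradients. Over glued sides `ψ (v - u)` is odd and the log-lengths agree, so the total is zero
(`IsUniform.eq_of_Psi_eq`). Each triangle contributes at most zero, and exactly zero only if its
angles agree (`sum_psi_mul_logSide_sub_le`). -/

/-! ### Hyperbolic trigonometry. -/

theorem cosh_dist_eq_sub_cos_hypAngle (z w₁ w₂ : ℍ) :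
    Real.cosh (dist w₁ w₂) = Real.cosh (dist z w₁) * Real.cosh (dist z w₂) -
      Real.sinh (dist z w₁) * Real.sinh (dist z w₂) * Real.cos (hypAngle z w₁ w₂) := by
  have sinh_eq (w : ℍ) : Real.sinh (dist z w) = ‖toDisc z w‖ *
      Complex.normSq ((w : ℂ) - (starRingEnd ℂ) (z : ℂ)) / (2 * z.im * w.im) := by
    have hz := z.im_pos
    have hw := w.im_pos
    have hne : (w : ℂ) - (starRingEnd ℂ) (z : ℂ) ≠ 0 := by
      intro h
      have := congrArg Complex.im h
      simp at this
      linarith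
    have hn : ‖(w : ℂ) - (starRingEnd ℂ) (z : ℂ)‖ ≠ 0 := norm_ne_zero_iff.mpr hne
    have hs : √(z.im * w.im) ^ 2 = z.im * w.im := Real.sq_sqrt (by positivity)
    have hs0 : √(z.im * w.im) ≠ 0 := by positivity
    have hconj : ‖(z : ℂ) - (starRingEnd ℂ) (w : ℂ)‖ = ‖(w : ℂ) - (starRingEnd ℂ) (z : ℂ)‖ := by
      rw [← Complex.norm_conj, map_sub, Complex.conj_conj, norm_sub_rev]
    have h2 : Real.sinh (dist z w) =
        2 * Real.sinh (dist z w / 2) * Real.cosh (dist z w / 2) := by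
      rw [← Real.sinh_two_mul]; ring_nf
    rw [h2, UpperHalfPlane.sinh_half_dist, UpperHalfPlane.cosh_half_dist, toDisc, norm_div,
      Complex.normSq_eq_norm_sq, Complex.dist_eq, Complex.dist_eq, norm_sub_rev (z : ℂ) w,
      hconj]
    field_simp
    rw [hs]
    ring
  -- Also true for zero vectors, so coinciding points need no separate case.
  have hinner := InnerProductGeometry.cos_angle_mul_norm_mul_norm (toDisc z w₁) (toDisc z w₂)
  have key : Real.sinh (dist z w₁) * Real.sinh (dist z w₂) * Real.cos (hypAngle z w₁ w₂) =
      inner ℝ (toDisc z w₁) (toDisc z w₂) *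
      Complex.normSq ((w₁ : ℂ) - (starRingEnd ℂ) (z : ℂ)) *
      Complex.normSq ((w₂ : ℂ) - (starRingEnd ℂ) (z : ℂ)) /
      (4 * z.im ^ 2 * w₁.im * w₂.im) := by
    rw [sinh_eq, sinh_eq, ← hinner, hypAngle]
    ring
  have hpos (w : ℍ) : (w.re - z.re) ^ 2 + (w.im + z.im) ^ 2 ≠ 0 := by
    have := z.im_pos
    have := w.im_pos
    positivity
  have hN (w : ℍ) : Complex.normSq ((w : ℂ) - (starRingEnd ℂ) (z : ℂ)) =
      (w.re - z.re) ^ 2 + (w.im + z.im) ^ 2 := by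
    simp [Complex.normSq_apply]; ring
  have h1 := hpos w₁
  have h2 := hpos w₂
  have hz := z.im_ne_zero
  have hw₁ := w₁.im_ne_zero
  have hw₂ := w₂.im_ne_zero
  rw [key, UpperHalfPlane.cosh_dist, UpperHalfPlane.cosh_dist, UpperHalfPlane.cosh_dist,
    Complex.inner, Complex.dist_eq, Complex.dist_eq, Complex.dist_eq, ← Complex.normSq_eq_norm_sq,
    ← Complex.normSq_eq_norm_sq, ← Complex.normSq_eq_norm_sq, toDisc, toDisc, Complex.mul_re,
    Complex.conj_re, Complex.conj_im, Complex.div_re, Complex.div_im, Complex.div_re,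
    Complex.div_im, hN, hN]
  simp only [Complex.normSq_apply, Complex.sub_re, Complex.sub_im, Complex.conj_re,
    Complex.conj_im, UpperHalfPlane.coe_re, UpperHalfPlane.coe_im]
  field_simp
  ring

/-- The second hyperbolic law of cosines, deduced from three instances of the first. -/
theorem cosh_mul_sin_mul_sin_of_cosh_eq {a b c A B C : ℝ} (ha : 0 < a) (hb : 0 < b) (hc : 0 < c)
    (hB : 0 < Real.sin B) (hC : 0 < Real.sin C)
    (h₁ : Real.cosh a = Real.cosh b * Real.cosh c - Real.sinh b * Real.sinh c * Real.cos A)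
    (h₂ : Real.cosh b = Real.cosh c * Real.cosh a - Real.sinh c * Real.sinh a * Real.cos B)
    (h₃ : Real.cosh c = Real.cosh a * Real.cosh b - Real.sinh a * Real.sinh b * Real.cos C) :
    Real.cosh a * (Real.sin B * Real.sin C) = Real.cos A + Real.cos B * Real.cos C := by
  have hsa := Real.sinh_pos_iff.mpr ha
  have hsb := Real.sinh_pos_iff.mpr hb
  have hsc := Real.sinh_pos_iff.mpr hc
  have hca := Real.cosh_sq a
  have hcb := Real.cosh_sq b
  have hcc := Real.cosh_sq c
  have hB2 := Real.sin_sq_add_cos_sq B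
  have hC2 := Real.sin_sq_add_cos_sq C
  generalize Real.cosh a = x, Real.cosh b = y, Real.cosh c = z, Real.sinh a = p,
    Real.sinh b = q, Real.sinh c = r, Real.sin B = sB, Real.sin C = sC, Real.cos A = cA,
    Real.cos B = cB, Real.cos C = cC at *
  have eA : cA = (y * z - x) / (q * r) := by field_simp; linarith
  have eB : cB = (z * x - y) / (r * p) := by field_simp; linarith
  have eC : cC = (x * y - z) / (p * q) := by field_simp; linarith
  have hp : p ^ 2 = x ^ 2 - 1 := by linarith
  have hq : q ^ 2 = y ^ 2 - 1 := by linarith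
  have hr : r ^ 2 = z ^ 2 - 1 := by linarith
  -- The Gram determinant is symmetric in the three sides; computing it from `B` and from `C` gives
  -- the law of sines `hBC`, where positivity selects the root.
  set D := 1 + 2 * x * y * z - x ^ 2 - y ^ 2 - z ^ 2 with hD
  have dB : (r * p * sB) ^ 2 = D := by
    have : (r * p * sB) ^ 2 = r ^ 2 * p ^ 2 - (r * p * cB) ^ 2 := by
      linear_combination (r * p) ^ 2 * hB2
    rw [this, show r * p * cB = z * x - y by linarith, hr, hp]; ring
  have dC : (p * q * sC) ^ 2 = D := by
    have : (p * q * sC) ^ 2 = p ^ 2 * q ^ 2 - (p * q * cC) ^ 2 := by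
      linear_combination (p * q) ^ 2 * hC2
    rw [this, show p * q * cC = x * y - z by linarith, hq, hp]; ring
  have hBC : r * p * sB = p * q * sC := by
    refine (sq_eq_sq₀ (by positivity) (by positivity)).mp (dB.trans dC.symm)
  have hprod : sB * sC = D / (p ^ 2 * q * r) := by
    have : D = r * p * sB * (p * q * sC) := by rw [← hBC, ← pow_two, dB]
    rw [eq_div_iff (by positivity), this]
    ring
  rw [hprod, eA, eB, eC]
  field_simp
  rw [hp]
  ring

theorem two_mul_cos_mul_cos_eq (A B C : ℝ) :
    2 * (Real.cos ((A + B + C) / 2) * Real.cos ((B + C - A) / 2)) =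
      Real.cos A + Real.cos (B + C) := by
  have h := Real.cos_add_cos (B + C) A
  rw [show (B + C + A) / 2 = (A + B + C) / 2 by ring] at h
  linarith

/-- Subtracting 1 from `cosh a` turns the numerator into `cos A + cos (B + C)`, which factors. The
logarithm thus splits into functions of single linear forms in the angles. -/
theorem log_cosh_sub_one_eq {a A B C : ℝ} (hA : 0 < A) (hB : 0 < B) (hC : 0 < C)
    (hS : A + B + C < Real.pi)
    (h : Real.cosh a * (Real.sin B * Real.sin C) = Real.cos A + Real.cos B * Real.cos C) :
    Real.log (Real.cosh a - 1) = Real.log 2 + Real.log (Real.cos ((A + B + C) / 2)) +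
      Real.log (Real.cos ((B + C - A) / 2)) - Real.log (Real.sin B) - Real.log (Real.sin C) := by
  have hsB : 0 < Real.sin B := Real.sin_pos_of_pos_of_lt_pi hB (by linarith)
  have hsC : 0 < Real.sin C := Real.sin_pos_of_pos_of_lt_pi hC (by linarith)
  have h1 : 0 < Real.cos ((A + B + C) / 2) :=
    Real.cos_pos_of_mem_Ioo ⟨by linarith, by linarith⟩
  have h2 : 0 < Real.cos ((B + C - A) / 2) :=
    Real.cos_pos_of_mem_Ioo ⟨by linarith, by linarith⟩
  have e : Real.cosh a - 1 = 2 * Real.cos ((A + B + C) / 2) * Real.cos ((B + C - A) / 2) /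
      Real.sin B / Real.sin C := by
    have := two_mul_cos_mul_cos_eq A B C
    rw [Real.cos_add] at this
    field_simp
    linarith
  rw [e, Real.log_div (by positivity) hsC.ne', Real.log_div (by positivity) hsB.ne',
    Real.log_mul (by positivity) h2.ne', Real.log_mul two_ne_zero h1.ne']

/-! ### Concavity of the volume of ideal tetrahedra. -/

theorem sum_cot_mul_sq_pos {a b c x y z : ℝ} (ha : 0 < a) (hb : 0 < b) (hc : 0 < c)
    (habc : a + b + c = Real.pi) (hxyz : x + y + z = 0) (hx : x ≠ 0) :
    0 < x * (Real.cos a * x / Real.sin a) + y * (Real.cos b * y / Real.sin b) +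
      z * (Real.cos c * z / Real.sin c) := by
  have hsa : 0 < Real.sin a := Real.sin_pos_of_pos_of_lt_pi ha (by linarith)
  have hsb : 0 < Real.sin b := Real.sin_pos_of_pos_of_lt_pi hb (by linarith)
  have hsc : 0 < Real.sin c := Real.sin_pos_of_pos_of_lt_pi hc (by linarith)
  have hsc' : Real.sin c = Real.sin (a + b) := by
    rw [← Real.sin_pi_sub, ← habc]; ring_nf
  have hcc' : Real.cos c = -Real.cos (a + b) := by
    rw [← Real.cos_pi_sub, ← habc]; ring_nf
  have hz : z = -(x + y) := by linarith
  have h1 := Real.sin_sq_add_cos_sq a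
  have h2 := Real.sin_sq_add_cos_sq b
  -- Eliminating `z` leaves a binary quadratic form in `x`, `y`; completing the square shows that it
  -- is positive definite.
  have e : x * (Real.cos a * x / Real.sin a) + y * (Real.cos b * y / Real.sin b) +
      z * (Real.cos c * z / Real.sin c) =
      ((Real.sin b * x + Real.cos c * (Real.sin a * y)) ^ 2 + (Real.sin c * (Real.sin a * y)) ^ 2) /
        (Real.sin a * Real.sin b * Real.sin c) := by
    have h3 : (Real.sin b * x + Real.cos c * (Real.sin a * y)) ^ 2 +
        (Real.sin c * (Real.sin a * y)) ^ 2 = (Real.sin b * x) ^ 2 + (Real.sin a * y) ^ 2 +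
        2 * Real.cos c * (Real.sin b * x) * (Real.sin a * y) := by
      linear_combination (Real.sin a * y) ^ 2 * Real.sin_sq_add_cos_sq c
    rw [h3]
    field_simp
    rw [hsc', hcc', hz, Real.sin_add, Real.cos_add]
    linear_combination (Real.sin b) ^ 2 * x ^ 2 * h1 + (Real.sin a) ^ 2 * y ^ 2 * h2
  rw [e]
  apply div_pos _ (by positivity)
  by_cases hy : y = 0
  · subst hy
    have : 0 < (Real.sin b * x) ^ 2 := by positivity
    simpa using this
  · have : 0 < (Real.sin c * (Real.sin a * y)) ^ 2 := by positivity
    positivity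

/-- The gradient of the volume of ideal tetrahedra, as a function of the dihedral angles, is strictly
monotone (up to sign). -/
theorem sum_sub_mul_log_sin_sub_pos {a b c a' b' c' : ℝ} (ha : 0 < a) (hb : 0 < b) (hc : 0 < c)
    (ha' : 0 < a') (hb' : 0 < b') (hc' : 0 < c') (h : a + b + c = Real.pi)
    (h' : a' + b' + c' = Real.pi) (hne : a ≠ a') :
    0 < (a' - a) * (Real.log (Real.sin a') - Real.log (Real.sin a)) +
      (b' - b) * (Real.log (Real.sin b') - Real.log (Real.sin b)) +
      (c' - c) * (Real.log (Real.sin c') - Real.log (Real.sin c)) := by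
  have pos {x x' t : ℝ} (hx : 0 < x) (hx' : 0 < x') (ht : t ∈ Set.Icc (0 : ℝ) 1) :
      0 < x + t * (x' - x) := by
    rcases ht with ⟨h0, h1⟩
    rcases h0.eq_or_lt with rfl | h0
    · simpa
    · nlinarith [mul_nonneg (sub_nonneg.mpr h1) hx.le, mul_pos h0 hx']
  -- Minus the derivative of the volume along the segment between the two triples; the constants
  -- `log 2` drop out because the increments sum to zero. The claim is `g 0 < g 1`.
  let g : ℝ → ℝ := fun t ↦ (a' - a) * Real.log (Real.sin (a + t * (a' - a))) +
    (b' - b) * Real.log (Real.sin (b + t * (b' - b))) +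
    (c' - c) * Real.log (Real.sin (c + t * (c' - c)))
  have hd : ∀ t ∈ Set.Icc (0 : ℝ) 1, ∃ d, HasDerivAt g d t ∧ 0 < d := by
    intro t ht
    have pa := pos ha ha' ht
    have pb := pos hb hb' ht
    have pc := pos hc hc' ht
    have hs : (a + t * (a' - a)) + (b + t * (b' - b)) + (c + t * (c' - c)) = Real.pi := by
      linear_combination (1 - t) * h + t * h'
    have der (x x' : ℝ) (hx : 0 < x + t * (x' - x)) (hx' : x + t * (x' - x) < Real.pi) :
        HasDerivAt (fun t ↦ (x' - x) * Real.log (Real.sin (x + t * (x' - x))))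
          ((x' - x) * (Real.cos (x + t * (x' - x)) * (x' - x) / Real.sin (x + t * (x' - x)))) t := by
      have h1 : HasDerivAt (fun t ↦ x + t * (x' - x)) (x' - x) t := by
        simpa using ((hasDerivAt_id t).mul_const (x' - x)).const_add x
      exact ((h1.sin).log (Real.sin_pos_of_pos_of_lt_pi hx hx').ne').const_mul _
    refine ⟨_, ((der a a' pa (by linarith)).add (der b b' pb (by linarith))).add
      (der c c' pc (by linarith)), ?_⟩
    exact sum_cot_mul_sq_pos pa pb pc hs (by linarith) (sub_ne_zero.mpr hne.symm)
  have hmono : StrictMonoOn g (Set.Icc 0 1) := by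
    refine strictMonoOn_of_deriv_pos (convex_Icc 0 1) (fun t ht ↦ ?_) (fun t ht ↦ ?_)
    · obtain ⟨d, hd, -⟩ := hd t ht
      exact hd.continuousAt.continuousWithinAt
    · rw [interior_Icc] at ht
      obtain ⟨d, hd, hpos⟩ := hd t (Set.Ioo_subset_Icc_self ht)
      rwa [hd.deriv]
  have := hmono (Set.left_mem_Icc.mpr zero_le_one) (Set.right_mem_Icc.mpr zero_le_one) zero_lt_one
  simp only [g, zero_mul, add_zero, one_mul, add_sub_cancel] at this
  linarith

theorem sum_sub_mul_log_sin_sub_nonneg {a b c a' b' c' : ℝ} (ha : 0 < a) (hb : 0 < b) (hc : 0 < c)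
    (ha' : 0 < a') (hb' : 0 < b') (hc' : 0 < c') (h : a + b + c = Real.pi)
    (h' : a' + b' + c' = Real.pi) :
    0 ≤ (a' - a) * (Real.log (Real.sin a') - Real.log (Real.sin a)) +
      (b' - b) * (Real.log (Real.sin b') - Real.log (Real.sin b)) +
      (c' - c) * (Real.log (Real.sin c') - Real.log (Real.sin c)) := by
  by_cases h1 : a = a'
  · by_cases h2 : b = b'
    · obtain rfl : c = c' := by linarith
      simp [h1, h2]
    · have := sum_sub_mul_log_sin_sub_pos hb ha hc hb' ha' hc' (by linarith) (by linarith) h2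
      linarith
  · exact (sum_sub_mul_log_sin_sub_pos ha hb hc ha' hb' hc' h h' h1).le

/-- Along a side of a hyperbolic triangle, `log (cosh ℓ - 1)` as a function of the angle `A` opposite
to it and the other two angles `B`, `C`, up to an additive constant. -/
noncomputable def logSide (A B C : ℝ) : ℝ :=
  Real.log (Real.cos ((A + B + C) / 2)) + Real.log (Real.cos ((B + C - A) / 2)) -
    Real.log (Real.sin B) - Real.log (Real.sin C)

/-- Minus the sum is a positive combination of the monotonicity inequalities of six ideal
tetrahedra, whose angles are made of `A`, `B`, `C`, the half sum `S` and the values `α`, `β`, `γ` of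
`ψ`. -/
theorem sum_psi_mul_logSide_sub_le {A B C A' B' C' : ℝ} (hA : 0 < A) (hB : 0 < B) (hC : 0 < C)
    (hA' : 0 < A') (hB' : 0 < B') (hC' : 0 < C') (h : A + B + C < Real.pi)
    (h' : A' + B' + C' < Real.pi) :
    ((B' + C' - A') / 2 - (B + C - A) / 2) * (logSide A' B' C' - logSide A B C) +
    ((C' + A' - B') / 2 - (C + A - B) / 2) * (logSide B' C' A' - logSide B C A) +
    ((A' + B' - C') / 2 - (A + B - C) / 2) * (logSide C' A' B' - logSide C A B) ≤ 0 ∧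
    (A ≠ A' →
    ((B' + C' - A') / 2 - (B + C - A) / 2) * (logSide A' B' C' - logSide A B C) +
    ((C' + A' - B') / 2 - (C + A - B) / 2) * (logSide B' C' A' - logSide B C A) +
    ((A' + B' - C') / 2 - (A + B - C) / 2) * (logSide C' A' B' - logSide C A B) < 0) := by
  have cs (x : ℝ) : Real.sin (Real.pi / 2 + x) = Real.cos x := by
    rw [add_comm, Real.sin_add_pi_div_two]
  let α := (B + C - A) / 2
  let β := (C + A - B) / 2
  let γ := (A + B - C) / 2
  let S := (A + B + C) / 2
  let α' := (B' + C' - A') / 2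
  let β' := (C' + A' - B') / 2
  let γ' := (A' + B' - C') / 2
  let S' := (A' + B' + C') / 2
  -- The angles add up to `π` because `S - α = A` here and `β + γ = A` in `r₁`, and likewise for the
  -- other corners.
  have t₁ := @sum_sub_mul_log_sin_sub_nonneg A (Real.pi / 2 - S) (Real.pi / 2 + α)
    A' (Real.pi / 2 - S') (Real.pi / 2 + α')
  have t₂ := @sum_sub_mul_log_sin_sub_nonneg B (Real.pi / 2 - S) (Real.pi / 2 + β)
    B' (Real.pi / 2 - S') (Real.pi / 2 + β')
  have t₃ := @sum_sub_mul_log_sin_sub_nonneg C (Real.pi / 2 - S) (Real.pi / 2 + γ)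
    C' (Real.pi / 2 - S') (Real.pi / 2 + γ')
  have r₁ := @sum_sub_mul_log_sin_sub_nonneg A (Real.pi / 2 - β) (Real.pi / 2 - γ)
    A' (Real.pi / 2 - β') (Real.pi / 2 - γ')
  have s₁ := @sum_sub_mul_log_sin_sub_pos A (Real.pi / 2 - β) (Real.pi / 2 - γ)
    A' (Real.pi / 2 - β') (Real.pi / 2 - γ')
  have r₂ := @sum_sub_mul_log_sin_sub_nonneg B (Real.pi / 2 - γ) (Real.pi / 2 - α)
    B' (Real.pi / 2 - γ') (Real.pi / 2 - α')
  have r₃ := @sum_sub_mul_log_sin_sub_nonneg C (Real.pi / 2 - α) (Real.pi / 2 - β)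
    C' (Real.pi / 2 - α') (Real.pi / 2 - β')
  simp only [Real.sin_pi_div_two_sub, cs] at t₁ t₂ t₃ r₁ s₁ r₂ r₃
  have e : ((B' + C' - A') / 2 - (B + C - A) / 2) * (logSide A' B' C' - logSide A B C) +
      ((C' + A' - B') / 2 - (C + A - B) / 2) * (logSide B' C' A' - logSide B C A) +
      ((A' + B' - C') / 2 - (A + B - C) / 2) * (logSide C' A' B' - logSide C A B) =
      (S' - S) * (Real.log (Real.cos S') - Real.log (Real.cos S)) +
      (α' - α) * (Real.log (Real.cos α') - Real.log (Real.cos α)) +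
      (β' - β) * (Real.log (Real.cos β') - Real.log (Real.cos β)) +
      (γ' - γ) * (Real.log (Real.cos γ') - Real.log (Real.cos γ)) -
      (A' - A) * (Real.log (Real.sin A') - Real.log (Real.sin A)) -
      (B' - B) * (Real.log (Real.sin B') - Real.log (Real.sin B)) -
      (C' - C) * (Real.log (Real.sin C') - Real.log (Real.sin C)) := by
    simp only [logSide, show (B + C + A) / 2 = S by ring, show (C + A + B) / 2 = S by ring,
      show (B' + C' + A') / 2 = S' by ring, show (C' + A' + B') / 2 = S' by ring]
    ring
  rw [e]
  replace t₁ := t₁ hA (by grind) (by grind) hA' (by grind) (by grind) (by grind) (by grind)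
  replace t₂ := t₂ hB (by grind) (by grind) hB' (by grind) (by grind) (by grind) (by grind)
  replace t₃ := t₃ hC (by grind) (by grind) hC' (by grind) (by grind) (by grind) (by grind)
  replace r₁ := r₁ hA (by grind) (by grind) hA' (by grind) (by grind) (by grind) (by grind)
  replace s₁ := s₁ hA (by grind) (by grind) hA' (by grind) (by grind) (by grind) (by grind)
  replace r₂ := r₂ hB (by grind) (by grind) hB' (by grind) (by grind) (by grind) (by grind)
  replace r₃ := r₃ hC (by grind) (by grind) hC' (by grind) (by grind) (by grind) (by grind)
  clear_value α β γ S α' β' γ' S'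
  refine ⟨?_, fun hne ↦ ?_⟩
  -- The weights are 1/3 on each `t` and 2/3 on each `r`.
  · linarith
  · have := s₁ hne
    linarith

/-! ### The kernel of `Ψ`. -/

namespace TriangulatedSurface

variable {F : Type*} (T : TriangulatedSurface F)

theorem psiSide_apply (s : F × Fin 3) (x : F × Fin 3 → ℝ) :
    psiSide s x = (x (s.1, s.2 + 1) + x (s.1, s.2 + 2) - x s) / 2 := by
  simp [psiSide]; ring

theorem edge_eq_edge_iff {s s' : F × Fin 3} : T.edge s' = T.edge s ↔ s' = s ∨ s' = T.adj s := by
  rw [eq_comm]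
  exact Quotient.eq (r := T.edgeSetoid)

theorem psiEdge_edge_of_isBoundarySide [Fintype F] {s : F × Fin 3} (hs : T.IsBoundarySide s) :
    T.psiEdge (T.edge s) = psiSide s := by
  classical
  have : ({s' | T.edge s' = T.edge s} : Finset (F × Fin 3)) = {s} := by
    ext s'
    simp [edge_eq_edge_iff, show T.adj s = s from hs]
  rw [psiEdge]
  convert Finset.sum_singleton _ s

theorem psiEdge_edge_of_not_isBoundarySide [Fintype F] {s : F × Fin 3}
    (hs : ¬ T.IsBoundarySide s) :
    T.psiEdge (T.edge s) = psiSide s + psiSide (T.adj s) := by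
  classical
  have : ({s' | T.edge s' = T.edge s} : Finset (F × Fin 3)) = {s, T.adj s} := by
    ext s'
    simp [edge_eq_edge_iff]
  rw [psiEdge]
  convert Finset.sum_pair (f := psiSide) (Ne.symm hs)

/-- Boundary sides are covered too: there `T.adj s = s`, so oddness forces `ψ` to vanish. -/
theorem mem_ker_Psi_iff [Fintype F] {x : F × Fin 3 → ℝ} :
    x ∈ LinearMap.ker T.Psi ↔ ∀ s, psiSide (T.adj s) x = -psiSide s x := by
  rw [LinearMap.mem_ker, funext_iff]
  constructor
  · intro h s
    have hs := h (T.edge s)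
    simp only [Psi, LinearMap.pi_apply, Pi.zero_apply] at hs
    by_cases hb : T.IsBoundarySide s
    · rw [T.psiEdge_edge_of_isBoundarySide hb] at hs
      rw [show T.adj s = s from hb, hs, neg_zero]
    · rw [T.psiEdge_edge_of_not_isBoundarySide hb, LinearMap.add_apply] at hs
      linarith
  · intro h e
    induction e using Quotient.inductionOn with | _ s =>
    change T.psiEdge (T.edge s) x = 0
    have hs := h s
    by_cases hb : T.IsBoundarySide s
    · rw [T.psiEdge_edge_of_isBoundarySide hb]
      rw [show T.adj s = s from hb] at hs
      linarith
    · rw [T.psiEdge_edge_of_not_isBoundarySide hb, LinearMap.add_apply]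
      linarith

theorem psiSide_sideVector [DecidableEq F] (s s' : F × Fin 3) :
    psiSide s (sideVector s') = if s = s' then 1 else 0 := by
  obtain ⟨t, i⟩ := s
  obtain ⟨t', i'⟩ := s'
  by_cases ht : t = t'
  · subst ht
    fin_cases i <;> fin_cases i' <;>
      simp [psiSide_apply, sideVector, Prod.ext_iff]
  · simp [psiSide_apply, sideVector, Prod.ext_iff, ht]

theorem sum_psiSide_smul_sideVector [Fintype F] (x : F × Fin 3 → ℝ) :
    ∑ s, psiSide s x • sideVector s = x := by
  classical
  ext ⟨t, i⟩
  rw [Finset.sum_apply, Fintype.sum_prod_type, Finset.sum_eq_single t]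
  · fin_cases i <;>
      simp [psiSide_apply, sideVector, Pi.single_apply, Prod.ext_iff, Fin.sum_univ_three] <;> ring
  · intro t' _ ht
    simp [sideVector, Prod.ext_iff, ht.symm]
  · simp

theorem sum_comp_adj [Fintype F] {M : Type*} [AddCommMonoid M] (f : F × Fin 3 → M) :
    ∑ s, f (T.adj s) = ∑ s, f s :=
  Function.Bijective.sum_comp (Function.Involutive.bijective T.adj_adj) f

theorem ker_Psi [Fintype F] : LinearMap.ker T.Psi = T.conformalDeformations := by
  classical
  apply le_antisymm
  · intro x hx
    rw [mem_ker_Psi_iff] at hx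
    -- The factor 1/2 appears because an interior edge is counted from both sides; coefficient and
    -- vector both change sign between them.
    have e : x = ∑ s, (psiSide s x / 2) • T.conformalVector s := by
      have h2 : ∑ s, (psiSide s x / 2) • sideVector (T.adj s) =
          ∑ s, (-(psiSide s x / 2)) • sideVector s := by
        rw [← T.sum_comp_adj (fun s ↦ (-(psiSide s x / 2)) • sideVector s)]
        refine Finset.sum_congr rfl fun s _ ↦ ?_
        rw [hx s]
        congr 1
        ring
      simp only [conformalVector, smul_sub, Finset.sum_sub_distrib]
      rw [h2, ← Finset.sum_sub_distrib]
      conv_lhs => rw [← sum_psiSide_smul_sideVector x]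
      refine Finset.sum_congr rfl fun s _ ↦ ?_
      rw [← sub_smul]
      congr 1
      ring
    rw [e]
    refine Submodule.sum_mem _ fun s _ ↦ Submodule.smul_mem _ _ ?_
    by_cases hb : T.IsBoundarySide s
    · rw [conformalVector, show T.adj s = s from hb, sub_self]
      exact Submodule.zero_mem _
    · exact Submodule.subset_span ⟨s, hb, rfl⟩
  · rw [conformalDeformations, Submodule.span_le]
    rintro _ ⟨s, -, rfl⟩
    rw [SetLike.mem_coe, mem_ker_Psi_iff]
    intro s'
    have h1 : T.adj s' = s ↔ s' = T.adj s :=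
      ⟨fun h ↦ by rw [← h, T.adj_adj], fun h ↦ by rw [h, T.adj_adj]⟩
    have h2 : T.adj s' = T.adj s ↔ s' = s := (Function.Involutive.injective T.adj_adj).eq_iff
    simp only [conformalVector, map_sub, psiSide_sideVector, h1, h2]
    ring

/-! ### Uniqueness of the uniform angle system. -/

/-- `logSide` of the angles at the side `s`. -/
noncomputable def logLength (x : F × Fin 3 → ℝ) (s : F × Fin 3) : ℝ :=
  logSide (x s) (x (s.1, s.2 + 1)) (x (s.1, s.2 + 2))

variable {T}

theorem log_cosh_sideLength_sub_one {x : F × Fin 3 → ℝ} {P : F → Fin 3 → ℍ}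
    (hP : IsRealization x P) (hpos : ∀ c, x c ∈ Set.Ioo 0 Real.pi)
    (hcurv : ∀ t, curvature t x < 0) (s : F × Fin 3) :
    Real.log (Real.cosh (sideLength P s) - 1) = Real.log 2 + logLength x s := by
  obtain ⟨t, i⟩ := s
  obtain ⟨hinj, hang⟩ := hP t
  have law (j : Fin 3) := cosh_dist_eq_sub_cos_hypAngle (P t j) (P t (j + 1)) (P t (j + 2))
  simp only [hang] at law
  have hsum : x (t, i) + x (t, i + 1) + x (t, i + 2) < Real.pi := by
    have := hcurv t
    rw [curvature, Fin.sum_univ_three] at this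
    fin_cases i <;> simp at this ⊢ <;> linarith
  have e1 : i + 1 + 1 = i + 2 := by fin_cases i <;> rfl
  have e2 : i + 1 + 2 = i := by fin_cases i <;> rfl
  have e3 : i + 2 + 1 = i := by fin_cases i <;> rfl
  have e4 : i + 2 + 2 = i + 1 := by fin_cases i <;> rfl
  have n1 : i + 1 ≠ i + 2 := by fin_cases i <;> decide
  have n2 : i + 2 ≠ i := by fin_cases i <;> decide
  have n3 : i ≠ i + 1 := by fin_cases i <;> decide
  have l1 := law i
  have l2 := law (i + 1)
  have l3 := law (i + 2)
  rw [e1, e2] at l2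
  rw [e3, e4] at l3
  rw [logLength, logSide, log_cosh_sub_one_eq (hpos (t, i)).1 (hpos (t, i + 1)).1
    (hpos (t, i + 2)).1 hsum]
  · ring
  refine cosh_mul_sin_mul_sin_of_cosh_eq (a := dist (P t (i + 1)) (P t (i + 2)))
    (b := dist (P t (i + 2)) (P t i)) (c := dist (P t i) (P t (i + 1)))
    (dist_pos.mpr (hinj.ne n1)) (dist_pos.mpr (hinj.ne n2)) (dist_pos.mpr (hinj.ne n3))
    (Real.sin_pos_of_mem_Ioo (hpos _)) (Real.sin_pos_of_mem_Ioo (hpos _)) ?_ ?_ ?_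
  · rw [l1, dist_comm (P t (i + 2)) (P t i)]
    ring
  · rw [l2, dist_comm (P t (i + 1)) (P t i)]
    ring
  · rw [l3, dist_comm (P t (i + 1)) (P t (i + 2))]
    ring

theorem IsUniform.logLength_adj [Fintype F] {u : F × Fin 3 → ℝ} (hu : T.IsUniform u)
    (s : F × Fin 3) : logLength u (T.adj s) = logLength u s := by
  obtain ⟨⟨-, -, hcurv, hpos⟩, P, hP, hlen⟩ := hu
  have h1 := log_cosh_sideLength_sub_one hP hpos hcurv s
  have h2 := log_cosh_sideLength_sub_one hP hpos hcurv (T.adj s)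
  rw [← hlen s] at h2
  linarith

theorem sum_psiSide_mul_logLength_sub_le {u v : F × Fin 3 → ℝ}
    (hu : ∀ c, 0 < u c) (hu' : ∀ t, curvature t u < 0)
    (hv : ∀ c, 0 < v c) (hv' : ∀ t, curvature t v < 0) (t : F) :
    ∑ i, psiSide (t, i) (v - u) * (logLength v (t, i) - logLength u (t, i)) ≤ 0 ∧
    (∑ i, psiSide (t, i) (v - u) * (logLength v (t, i) - logLength u (t, i)) = 0 →
      ∀ i, u (t, i) = v (t, i)) := by
  have hut := hu' t
  have hvt := hv' t
  simp only [curvature, Fin.sum_univ_three] at hut hvt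
  have e₁ : (1 : Fin 3) + 1 = 2 := rfl
  have e₂ : (1 : Fin 3) + 2 = 0 := rfl
  have e₃ : (2 : Fin 3) + 1 = 0 := rfl
  have e₄ : (2 : Fin 3) + 2 = 1 := rfl
  have h₀ := sum_psi_mul_logSide_sub_le (hu (t, 0)) (hu (t, 1)) (hu (t, 2)) (hv (t, 0))
    (hv (t, 1)) (hv (t, 2)) (by linarith) (by linarith)
  have h₁ := sum_psi_mul_logSide_sub_le (hu (t, 1)) (hu (t, 2)) (hu (t, 0)) (hv (t, 1))
    (hv (t, 2)) (hv (t, 0)) (by linarith) (by linarith)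
  have h₂ := sum_psi_mul_logSide_sub_le (hu (t, 2)) (hu (t, 0)) (hu (t, 1)) (hv (t, 2))
    (hv (t, 0)) (hv (t, 1)) (by linarith) (by linarith)
  -- The sum is invariant under cyclic relabelling, so strictness for the first angle yields it for
  -- every corner.
  have main (i : Fin 3) :
      ∑ i, psiSide (t, i) (v - u) * (logLength v (t, i) - logLength u (t, i)) ≤ 0 ∧
      (u (t, i) ≠ v (t, i) →
        ∑ i, psiSide (t, i) (v - u) * (logLength v (t, i) - logLength u (t, i)) < 0) := by
    simp only [map_sub, psiSide_apply, logLength, Fin.sum_univ_three, zero_add, e₁, e₂, e₃, e₄]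
    refine ⟨by linarith [h₀.1], ?_⟩
    fin_cases i <;> intro hne
    · linarith [h₀.2 hne]
    · linarith [h₁.2 hne]
    · linarith [h₂.2 hne]
  refine ⟨(main 0).1, fun h i ↦ ?_⟩
  by_contra hne
  exact ((main i).2 hne).ne h

theorem IsUniform.eq_of_Psi_eq [Fintype F] {u v : F × Fin 3 → ℝ} (hu : T.IsUniform u)
    (hv : T.IsUniform v) (h : T.Psi u = T.Psi v) : u = v := by
  have hker : v - u ∈ LinearMap.ker T.Psi := by simp [LinearMap.mem_ker, h]
  rw [mem_ker_Psi_iff] at hker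
  -- Reindexing by `T.adj` negates the first factor and fixes the second, so the sum equals its own
  -- negative.
  have hzero : ∑ s, psiSide s (v - u) * (logLength v s - logLength u s) = 0 := by
    have := T.sum_comp_adj fun s ↦ psiSide s (v - u) * (logLength v s - logLength u s)
    simp only [hker, hu.logLength_adj, hv.logLength_adj, neg_mul, Finset.sum_neg_distrib] at this
    linarith
  have tri := sum_psiSide_mul_logLength_sub_le (fun c ↦ (hu.1.2.2.2 c).1) hu.1.2.2.1
    (fun c ↦ (hv.1.2.2.2 c).1) hv.1.2.2.1
  rw [Fintype.sum_prod_type, Finset.sum_eq_zero_iff_of_nonpos fun t _ ↦ (tri t).1] at hzero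
  ext ⟨t, i⟩
  exact (tri t).2 (hzero t (Finset.mem_univ t)) i

end TriangulatedSurface

theorem corollary2p3 {F : Type*} [Fintype F] (T : TriangulatedSurface F) :
    LinearMap.ker T.Psi = T.conformalDeformations ∧
      ∀ (p : T.Edge → ℝ) (u v : F × Fin 3 → ℝ),
        T.IsUniform u → T.IsUniform v → T.Psi u = p → T.Psi v = p → u = v :=
  ⟨T.ker_Psi, fun _ _ _ hu hv hup hvp ↦ hu.eq_of_Psi_eq hv (hup.trans hvp.symm)⟩
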